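/- Let $n \ge 3$ and let $P = P_1P_2\cdots P_n$ be a (strictly) convex polygon with $n$ vertices. A triangulation of $P$ is given by a maximal set of pairwise non-crossing diagonals of $P$; these cut $P$ into triangles whose vertices are vertices of $P$. The quiddity of a triangulation is the sequence $(d_1,\ldots,d_n)$ in which $d_i$ is the number of triangles of the triangulation having $P_i$ as a vertex, and its parity sequence is $(d_1 \bmod 2,\ldots,d_n \bmod 2) \in \mathbb{F}_2^n$. For integers $m\ge 1$ and $q>1$ write $$[m]_q := \frac{q^m-1}{q-1}, \qquad \binom{m}{2}_q := \frac{(q^m-1)(q^{m-1}-1)}{(q-1)(q^2-1)}.$$ (i) If $n$ is odd, the number of distinct sequences in $\mathbb{F}_2^n$ that occur as the parity sequence of some triangulation of $P$ is $\left[\frac{n-1}{2}\right]_4$. (ii) If $n = 2m$ is even, this number is $\binom{m}{2}_2 + 2^{m-1} - 1$. -/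

import Mathlib

/-- Twice the signed area of the triangle `ABC` in the Euclidean plane. It is positive iff `A, B, C`
turn counterclockwise, negative iff they turn clockwise, and zero iff they are collinear. -/
def signedArea (A B C : EuclideanSpace ℝ (Fin 2)) : ℝ :=
  (B 0 - A 0) * (C 1 - A 1) - (B 1 - A 1) * (C 0 - A 0)

/-- `P 0, P 1, …, P (n-1)` are the consecutive vertices of a (strictly) convex polygon, traversed
counterclockwise or clockwise: any three of them, taken in order, turn in the same sense. -/
def IsConvexPolygon {n : ℕ} (P : Fin n → EuclideanSpace ℝ (Fin 2)) : Prop :=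
  (∀ i j k : Fin n, i < j → j < k → 0 < signedArea (P i) (P j) (P k)) ∨
    (∀ i j k : Fin n, i < j → j < k → signedArea (P i) (P j) (P k) < 0)

/-- Draw every edge `ab` of the graph `G` as the straight segment from `P a` to `P b`. No two
distinct edges cross: their relative interiors are disjoint. -/
def IsNonCrossing {n : ℕ} (P : Fin n → EuclideanSpace ℝ (Fin 2)) (G : SimpleGraph (Fin n)) :
    Prop :=
  ∀ a b c d : Fin n, G.Adj a b → G.Adj c d → s(a, b) ≠ s(c, d) →
    Disjoint (openSegment ℝ (P a) (P b)) (openSegment ℝ (P c) (P d))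

/-- A triangulation of the polygon `P`, given by the graph of its edges: the sides of the polygon
together with a maximal set of diagonals that do not cross one another inside the polygon. -/
def IsTriangulation {n : ℕ} (P : Fin n → EuclideanSpace ℝ (Fin 2)) (G : SimpleGraph (Fin n)) :
    Prop :=
  Maximal (fun H : SimpleGraph (Fin n) => SimpleGraph.cycleGraph n ≤ H ∧ IsNonCrossing P H) G

/-- The quiddity of a triangulation: the number of its triangles that use the vertex `i`. As all
vertices lie on the boundary of a convex polygon, no diagonal of the triangulation can enter the
triangle spanned by three pairwise joined vertices, so the triangles of the triangulation are
exactly the triples of pairwise joined vertices. -/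
noncomputable def quiddity {n : ℕ} (G : SimpleGraph (Fin n)) (i : Fin n) : ℕ :=
  {t : Finset (Fin n) | G.IsNClique 3 t ∧ i ∈ t}.ncard

/-- The parity sequence of a triangulation: its quiddity reduced modulo `2`. -/
noncomputable def paritySequence {n : ℕ} (G : SimpleGraph (Fin n)) : Fin n → ZMod 2 :=
  fun i => (quiddity G i : ZMod 2)

/-- The set of all parity sequences of triangulations of the polygon `P`. -/
def paritySequences {n : ℕ} (P : Fin n → EuclideanSpace ℝ (Fin 2)) : Set (Fin n → ZMod 2) :=
  {c | ∃ G : SimpleGraph (Fin n), IsTriangulation P G ∧ paritySequence G = c}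

/-- The `q`-integer `[m]_q`, for `m ≥ 1` and `q > 1`. -/
def qInteger (q m : ℕ) : ℚ := ((q : ℚ) ^ m - 1) / ((q : ℚ) - 1)

/-- The `q`-binomial coefficient `binom(m, 2)_q`, for `m ≥ 1` and `q > 1`. -/
def qBinomTwo (q m : ℕ) : ℚ :=
  (((q : ℚ) ^ m - 1) * ((q : ℚ) ^ (m - 1) - 1)) / (((q : ℚ) - 1) * ((q : ℚ) ^ 2 - 1))

/-! A triangulation has a proper 3-colouring of its vertices, unique once the colours of two
adjacent vertices are prescribed. Around a vertex the far ends of its edges alternate between the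
two other colours, so `d_i` is even exactly when the two polygon neighbours of `P_i` share a colour
(`Dissects.triangleCount_parity`). The parity sequence is thus a function of the colouring of the
boundary cycle.

Conversely, every proper 3-colouring of the cycle that uses all three colours comes from a
triangulation (`exists_dissects`), and with the colours of the first and last vertex fixed, the
parity bits recover it vertex by vertex (`colorParity_injOn`). So the parity sequences correspond to
proper 3-colourings of the `n`-cycle with two adjacent colours fixed and the third colour present.
With `k = n - 1` there are `(2^k - (-1)^k)/3` colourings with the two colours fixed, and one of
them, the alternating one, must be discarded when `n` is even.

Geometry enters only through `isNonCrossing_iff_crossingFree`. Afterwards graphs are moved to `ℕ`,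
where each subpolygon cut off by a diagonal is an interval `[a, b]` with base `ab`, and inductions
remove the triangle on the base. -/

/-- No two edges of `G` have interlaced endpoints. -/
def CrossingFree {α : Type*} [LT α] (G : SimpleGraph α) : Prop :=
  ∀ a b c d : α, a < b → b < c → c < d → G.Adj a c → ¬ G.Adj b d

/-! ### Crossing segments and interlaced indices. -/

section Geometry

variable {A B C D : EuclideanSpace ℝ (Fin 2)}

theorem signedArea_rotate (A B C : EuclideanSpace ℝ (Fin 2)) :
    signedArea B C A = signedArea A B C := by
  unfold signedArea; ring

theorem signedArea_left_self (A B : EuclideanSpace ℝ (Fin 2)) : signedArea A B A = 0 := by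
  unfold signedArea; ring

theorem signedArea_right_self (A B : EuclideanSpace ℝ (Fin 2)) : signedArea A B B = 0 := by
  unfold signedArea; ring

/-- The diagonals of a convex quadrilateral cross. -/
theorem not_disjoint_openSegment_of_pos (hABC : 0 < signedArea A B C)
    (hABD : 0 < signedArea A B D) (hACD : 0 < signedArea A C D) (hBCD : 0 < signedArea B C D) :
    ¬ Disjoint (openSegment ℝ A C) (openSegment ℝ B D) := by
  have hsum : signedArea A B C + signedArea A C D = signedArea A B D + signedArea B C D := by
    unfold signedArea; ring
  have hs : 0 < signedArea A B D + signedArea B C D := by positivity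
  rw [Set.not_disjoint_iff]
  -- The intersection point of the diagonals: each endpoint is weighted by the area of the triangle
  -- formed by the opposite endpoint and the other diagonal. Both pairs of weights sum to the area
  -- of the quadrilateral, by `hsum`.
  refine ⟨(signedArea B C D / (signedArea A B D + signedArea B C D)) • A +
    (signedArea A B D / (signedArea A B D + signedArea B C D)) • C,
    ⟨_, _, by positivity, by positivity, by field_simp; ring, rfl⟩,
    ⟨signedArea A C D / (signedArea A B D + signedArea B C D),
      signedArea A B C / (signedArea A B D + signedArea B C D),
      by positivity, by positivity, by field_simp; linarith, ?_⟩⟩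
  ext i
  fin_cases i <;> simp <;> field_simp <;> unfold signedArea <;> ring

/-- A segment on one side of the line through another one does not cross it. -/
theorem disjoint_openSegment_of_nonneg (hB : 0 ≤ signedArea A C B) (hD : 0 ≤ signedArea A C D)
    (h : 0 < signedArea A C B + signedArea A C D) :
    Disjoint (openSegment ℝ A C) (openSegment ℝ B D) := by
  rw [Set.disjoint_left]
  rintro _ ⟨s, t, -, -, hst, rfl⟩ ⟨u, v, hu, hv, huv, hX⟩
  have h0 := congrArg (fun Z => Z 0) hX
  have h1 := congrArg (fun Z => Z 1) hX
  simp only [PiLp.add_apply, PiLp.smul_apply, smul_eq_mul] at h0 h1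
  -- The affine function `signedArea A C ·` vanishes on the line `AC`, hence at a common point of
  -- the two segments.
  have key : u * signedArea A C B + v * signedArea A C D = 0 := by
    obtain rfl : s = 1 - t := by linarith
    obtain rfl : u = 1 - v := by linarith
    unfold signedArea
    linear_combination (C 0 - A 0) * h1 - (C 1 - A 1) * h0
  rcases hB.eq_or_lt with hB0 | hB0
  · have : 0 < signedArea A C D := by linarith
    have := mul_pos hv this
    rw [← hB0] at key
    linarith
  · have := mul_pos hu hB0
    have := mul_nonneg hv.le hD
    linarith

end Geometry

theorem crossingFree_iff_of_pos {n : ℕ} {P : Fin n → EuclideanSpace ℝ (Fin 2)}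
    (hP : ∀ i j k : Fin n, i < j → j < k → 0 < signedArea (P i) (P j) (P k))
    (G : SimpleGraph (Fin n)) : IsNonCrossing P G ↔ CrossingFree G := by
  constructor
  · intro h a b c d hab hbc hcd hac hbd
    refine not_disjoint_openSegment_of_pos (hP a b c hab hbc) (hP a b d hab (hbc.trans hcd))
      (hP a c d (hab.trans hbc) hcd) (hP b c d hbc hcd) (h a c b d hac hbd ?_)
    rw [Ne, Sym2.eq_iff]
    rintro (⟨rfl, -⟩ | ⟨rfl, -⟩)
    · exact hab.false
    · exact (hab.trans (hbc.trans hcd)).false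
  · intro h
    -- Vertices outside the index interval `(a, b)` lie weakly left of the directed line `ab`; by
    -- `inner`, those in `[a, b]` lie weakly right of it. Two edges that do not interlace are
    -- therefore separated by the line of one of them.
    have outer (a b x : Fin n) (hab : a < b) (hx : x ≤ a ∨ b ≤ x) :
        0 ≤ signedArea (P a) (P b) (P x) ∧
          (x ≠ a → x ≠ b → 0 < signedArea (P a) (P b) (P x)) := by
      rcases hx with hx | hx <;> rcases hx.eq_or_lt with rfl | hx
      · simp [signedArea_left_self]
      · have := hP x a b hx hab
        rw [← signedArea_rotate] at this
        exact ⟨this.le, fun _ _ => this⟩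
      · simp [signedArea_right_self]
      · have := hP a b x hab hx
        exact ⟨this.le, fun _ _ => this⟩
    have inner (a b x : Fin n) (hx : a ≤ x ∧ x ≤ b) :
        0 ≤ signedArea (P b) (P a) (P x) ∧
          (x ≠ a → x ≠ b → 0 < signedArea (P b) (P a) (P x)) := by
      rcases hx with ⟨h1, h2⟩
      rcases h1.eq_or_lt with rfl | h1
      · simp [signedArea_right_self]
      rcases h2.eq_or_lt with rfl | h2
      · simp [signedArea_left_self]
      have := hP a x b h1 h2
      rw [← signedArea_rotate, ← signedArea_rotate] at this
      exact ⟨this.le, fun _ _ => this⟩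
    have main (a b c d : Fin n) (hab : G.Adj a b) (hcd : G.Adj c d) (hne : s(a, b) ≠ s(c, d))
        (h1 : a < b) (h2 : c < d) :
        Disjoint (openSegment ℝ (P a) (P b)) (openSegment ℝ (P c) (P d)) := by
      have hne' : (c ≠ a ∧ c ≠ b) ∨ (d ≠ a ∧ d ≠ b) := by
        by_contra hcon
        apply hne
        rw [Sym2.eq_iff]
        grind
      by_cases ho : (c ≤ a ∨ b ≤ c) ∧ (d ≤ a ∨ b ≤ d)
      · have hc := outer a b c h1 ho.1
        have hd := outer a b d h1 ho.2
        refine disjoint_openSegment_of_nonneg hc.1 hd.1 ?_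
        rcases hne' with hne' | hne'
        · exact add_pos_of_pos_of_nonneg (hc.2 hne'.1 hne'.2) hd.1
        · exact add_pos_of_nonneg_of_pos hc.1 (hd.2 hne'.1 hne'.2)
      by_cases hi : (a ≤ c ∧ c ≤ b) ∧ (a ≤ d ∧ d ≤ b)
      · have hc := inner a b c hi.1
        have hd := inner a b d hi.2
        rw [openSegment_symm]
        refine disjoint_openSegment_of_nonneg hc.1 hd.1 ?_
        rcases hne' with hne' | hne'
        · exact add_pos_of_pos_of_nonneg (hc.2 hne'.1 hne'.2) hd.1
        · exact add_pos_of_nonneg_of_pos hc.1 (hd.2 hne'.1 hne'.2)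
      · exfalso
        have h3 := h a c b d
        have h4 := h c a d b
        grind
    intro a b c d hab hcd hne
    rcases lt_or_gt_of_ne hab.ne with h1 | h1 <;> rcases lt_or_gt_of_ne hcd.ne with h2 | h2
    · exact main a b c d hab hcd hne h1 h2
    · rw [openSegment_symm ℝ (P c)]
      exact main a b d c hab hcd.symm (by rwa [Sym2.eq_swap (a := d)]) h1 h2
    · rw [openSegment_symm ℝ (P a)]
      exact main b a c d hab.symm hcd (by rwa [Sym2.eq_swap (a := b)]) h1 h2
    · rw [openSegment_symm ℝ (P c), openSegment_symm ℝ (P a)]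
      exact main b a d c hab.symm hcd.symm
        (by rwa [Sym2.eq_swap (a := b), Sym2.eq_swap (a := d)]) h1 h2

/-- Reflecting the plane turns a clockwise polygon into a counterclockwise one. -/
noncomputable def planeReflection : EuclideanSpace ℝ (Fin 2) ≃ₗ[ℝ] EuclideanSpace ℝ (Fin 2) :=
  LinearEquiv.ofInvolutive
    { toFun := fun A => !₂[A 0, -A 1]
      map_add' := fun A B => by ext i; fin_cases i <;> simp; ring
      map_smul' := fun r A => by ext i; fin_cases i <;> simp }
    (fun A => by ext i; fin_cases i <;> simp)

theorem planeReflection_apply (A : EuclideanSpace ℝ (Fin 2)) :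
    planeReflection A = !₂[A 0, -A 1] := rfl

theorem signedArea_planeReflection (A B C : EuclideanSpace ℝ (Fin 2)) :
    signedArea (planeReflection A) (planeReflection B) (planeReflection C) =
      -signedArea A B C := by
  simp [signedArea, planeReflection_apply]; ring

/-- For the vertices of a convex polygon, crossing of segments is interlacing of indices. -/
theorem isNonCrossing_iff_crossingFree {n : ℕ} {P : Fin n → EuclideanSpace ℝ (Fin 2)}
    (hP : IsConvexPolygon P) (G : SimpleGraph (Fin n)) :
    IsNonCrossing P G ↔ CrossingFree G := by
  rcases hP with hP | hP
  · exact crossingFree_iff_of_pos hP G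
  · rw [← crossingFree_iff_of_pos (P := fun i => planeReflection (P i))
      (fun i j k hij hjk => by
        rw [signedArea_planeReflection]; linarith [hP i j k hij hjk])]
    refine forall₄_congr fun a b c d => ?_
    have hseg (A B : EuclideanSpace ℝ (Fin 2)) :
        openSegment ℝ (planeReflection A) (planeReflection B) =
          planeReflection '' openSegment ℝ A B :=
      (image_openSegment ℝ planeReflection.toLinearMap.toAffineMap A B).symm
    rw [hseg, hseg, Set.disjoint_image_iff planeReflection.injective]

/-! ### Dissections of intervals and their 3-colourings. -/

section Dissection

variable {G : SimpleGraph ℕ} {a b : ℕ}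

/-- `G` contains a triangulation of the polygon with vertices `a, a + 1, …, b`. -/
inductive Dissects (G : SimpleGraph ℕ) : ℕ → ℕ → Prop
  | side (a : ℕ) : G.Adj a (a + 1) → Dissects G a (a + 1)
  | triangle (a k b : ℕ) : G.Adj a b → Dissects G a k → Dissects G k b → Dissects G a b

theorem Dissects.lt (h : Dissects G a b) : a < b := by
  induction h <;> omega

theorem Dissects.adj (h : Dissects G a b) : G.Adj a b := by
  cases h <;> assumption

theorem Dissects.mono {H : SimpleGraph ℕ} (hGH : G ≤ H) (h : Dissects G a b) :
    Dissects H a b := by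
  induction h with
  | side a h => exact .side a (hGH h)
  | triangle a k b h _ _ h1 h2 => exact .triangle a k b (hGH h) h1 h2

theorem Dissects.adj_succ (h : Dissects G a b) {i : ℕ} (hai : a ≤ i) (hib : i < b) :
    G.Adj i (i + 1) := by
  induction h with
  | side a h =>
    rwa [show i = a by omega]
  | triangle a k b h _ _ h1 h2 =>
    rcases lt_or_ge i k with hik | hik
    · exact h1 hai hik
    · exact h2 hik hib

/-- A dissection cannot be refined without crossings. -/
theorem Dissects.adj_of_le {H : SimpleGraph ℕ} (h : Dissects G a b) (hGH : G ≤ H)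
    (hH : CrossingFree H) {u v : ℕ} (hau : a ≤ u) (huv : u < v) (hvb : v ≤ b)
    (hadj : H.Adj u v) : G.Adj u v := by
  induction h with
  | side a h =>
    rwa [show u = a by omega, show v = a + 1 by omega]
  | triangle a k b h hak hkb h1 h2 =>
    rcases le_or_gt v k with hvk | hvk
    · exact h1 hau hvk
    rcases le_or_gt k u with hku | hku
    · exact h2 hku hvb
    rcases hau.eq_or_lt with rfl | hau
    · rcases hvb.eq_or_lt with rfl | hvb
      · exact h
      · exact (hH _ k v b hku hvk hvb hadj (hGH hkb.adj)).elim
    · exact (hH a u k v hau hku hvk (hGH hak.adj) hadj).elim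

/-- The colours of the endpoints of a dissected interval extend to a proper colouring. -/
theorem Dissects.exists_coloring (h : Dissects G a b) (hG : CrossingFree G) (x y : Fin 3)
    (hxy : x ≠ y) : ∃ f : ℕ → Fin 3, f a = x ∧ f b = y ∧
      ∀ u v, a ≤ u → u < v → v ≤ b → G.Adj u v → f u ≠ f v := by
  induction h generalizing x y with
  | side a h =>
    refine ⟨fun i => if i = a then x else y, by simp, by simp, fun u v _ _ _ _ => ?_⟩
    simpa only [show u = a by omega, show v ≠ a by omega, if_true, if_false] using hxy
  | triangle a k b h hak hkb h1 h2 =>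
    obtain ⟨z, hxz, hzy⟩ : ∃ z : Fin 3, x ≠ z ∧ z ≠ y := by
      revert x y; decide
    obtain ⟨f, hfa, hfk, hf⟩ := h1 x z hxz
    obtain ⟨g, hgk, hgb, hg⟩ := h2 z y hzy
    have hak' := hak.lt
    have hkb' := hkb.lt
    refine ⟨fun i => if i ≤ k then f i else g i, ?_, ?_, fun u v hau huv hvb hadj => ?_⟩
    · simp only [hak'.le, if_true, hfa]
    · simp only [hkb'.not_ge, if_false, hgb]
    -- An edge passing over `k` must be `ab` itself: otherwise it crosses `kb` (`c1`) or `ak`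
    -- (`c2`).
    have c1 := hG u k v b
    have c2 := hG a u k v
    have a1 := hak.adj
    have a2 := hkb.adj
    have f1 := hf u v
    have g1 := hg u v
    grind

/-! ### Triangle counts modulo 2. -/

/-- The number of triangles of `G` with vertices in `[a, b]` that use the vertex `i`. -/
noncomputable def triangleCount (G : SimpleGraph ℕ) (a b i : ℕ) : ℕ :=
  {t : Finset ℕ | G.IsNClique 3 t ∧ t ⊆ Finset.Icc a b ∧ i ∈ t}.ncard

theorem finite_triangles (G : SimpleGraph ℕ) (a b i : ℕ) :
    {t : Finset ℕ | G.IsNClique 3 t ∧ t ⊆ Finset.Icc a b ∧ i ∈ t}.Finite :=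
  (Finset.finite_toSet (Finset.Icc a b).powerset).subset fun _ ht =>
    Finset.mem_coe.2 (Finset.mem_powerset.2 ht.2.1)

theorem triangleCount_eq_zero {i : ℕ} (hi : i < a ∨ b < i) : triangleCount G a b i = 0 := by
  rw [triangleCount, Set.ncard_eq_zero (finite_triangles G a b i)]
  ext t
  simp only [Set.mem_ofPred_eq, Set.mem_empty_iff_false, iff_false]
  rintro ⟨-, h, hit⟩
  have := Finset.mem_Icc.1 (h hit)
  omega

theorem triangleCount_succ (a i : ℕ) : triangleCount G a (a + 1) i = 0 := by
  rw [triangleCount, Set.ncard_eq_zero (finite_triangles G a _ i)]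
  ext t
  simp only [Set.mem_ofPred_eq, Set.mem_empty_iff_false, iff_false]
  rintro ⟨h3, h, -⟩
  have := Finset.card_le_card h
  rw [h3.card_eq, Nat.card_Icc] at this
  omega

/-- A clique with vertices on both sides of `k` contains an edge over `k`. Not crossing `ak` or `kb`
forces that edge to be `ab`, which leaves only `k` as third vertex. -/
theorem isNClique_three_split {k : ℕ} (hG : CrossingFree G)
    (h1 : G.Adj a k) (h2 : G.Adj k b) {t : Finset ℕ} (ht : G.IsNClique 3 t)
    (htab : t ⊆ Finset.Icc a b) :
    t ⊆ Finset.Icc a k ∨ t ⊆ Finset.Icc k b ∨ t = {a, k, b} := by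
  by_contra! hcon
  obtain ⟨hl, hr, hne⟩ := hcon
  obtain ⟨v, hv, hv'⟩ := Finset.not_subset.1 hl
  obtain ⟨u, hu, hu'⟩ := Finset.not_subset.1 hr
  have hv2 := Finset.mem_Icc.1 (htab hv)
  have hu2 := Finset.mem_Icc.1 (htab hu)
  have hkv : k < v := by rw [Finset.mem_Icc] at hv'; omega
  have huk : u < k := by rw [Finset.mem_Icc] at hu'; omega
  have key (w w' : ℕ) (hw : w ∈ t) (hw' : w' ∈ t) (hwk : w < k) (hkw : k < w') :
      w = a ∧ w' = b := by
    have hadj : G.Adj w w' := ht.isClique hw hw' (by omega)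
    have := Finset.mem_Icc.1 (htab hw)
    have := Finset.mem_Icc.1 (htab hw')
    constructor
    · by_contra hwa
      exact hG a w k w' (by omega) hwk hkw h1 hadj
    · by_contra hwb
      exact hG w k w' b hwk hkw (by omega) hadj h2
  apply hne
  refine Finset.eq_of_subset_of_card_le (fun w hw => ?_) ?_
  · simp only [Finset.mem_insert, Finset.mem_singleton]
    rcases lt_trichotomy w k with hwk | hwk | hwk
    · exact .inl (key w v hw hv hwk hkv).1
    · exact .inr (.inl hwk)
    · exact .inr (.inr (key u w hu hw huk hwk).2)
  · rw [ht.card_eq]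
    exact Finset.card_le_three

theorem triangleCount_split {k : ℕ} (hG : CrossingFree G) (hak : a < k) (hkb : k < b)
    (h1 : G.Adj a k) (h2 : G.Adj k b) (h3 : G.Adj a b) (i : ℕ) :
    triangleCount G a b i = triangleCount G a k i + triangleCount G k b i +
      if i = a ∨ i = k ∨ i = b then 1 else 0 := by
  have hset : {t : Finset ℕ | G.IsNClique 3 t ∧ t ⊆ Finset.Icc a b ∧ i ∈ t} =
      ({t : Finset ℕ | G.IsNClique 3 t ∧ t ⊆ Finset.Icc a k ∧ i ∈ t} ∪
        {t : Finset ℕ | G.IsNClique 3 t ∧ t ⊆ Finset.Icc k b ∧ i ∈ t}) ∪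
      {t | t = {a, k, b} ∧ i ∈ t} := by
    ext t
    simp only [Set.mem_union, Set.mem_ofPred_eq]
    constructor
    · rintro ⟨ht, htab, hit⟩
      rcases isNClique_three_split hG h1 h2 ht htab with h | h | h
      · exact .inl (.inl ⟨ht, h, hit⟩)
      · exact .inl (.inr ⟨ht, h, hit⟩)
      · exact .inr ⟨h, hit⟩
    · rintro ((⟨ht, h, hit⟩ | ⟨ht, h, hit⟩) | ⟨rfl, hit⟩)
      · exact ⟨ht, h.trans (Finset.Icc_subset_Icc_right hkb.le), hit⟩
      · exact ⟨ht, h.trans (Finset.Icc_subset_Icc_left hak.le), hit⟩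
      · refine ⟨SimpleGraph.is3Clique_triple_iff.2 ⟨h1, h3, h2⟩, ?_, hit⟩
        intro w hw
        simp only [Finset.mem_insert, Finset.mem_singleton] at hw
        rw [Finset.mem_Icc]
        omega
  have hfin : {t : Finset ℕ | t = {a, k, b} ∧ i ∈ t}.Finite :=
    (Set.finite_singleton {a, k, b}).subset fun _ ht => ht.1
  unfold triangleCount
  rw [hset, Set.ncard_union_eq ?_ ((finite_triangles ..).union (finite_triangles ..)) hfin,
    Set.ncard_union_eq ?_ (finite_triangles ..) (finite_triangles ..)]
  · congr 1
    split_ifs with hi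
    · rw [Set.ncard_eq_one]
      refine ⟨{a, k, b}, ?_⟩
      ext t
      simp only [Set.mem_ofPred_eq, Set.mem_singleton_iff, and_iff_left_iff_imp]
      rintro rfl
      simpa using hi
    · rw [Set.ncard_eq_zero hfin]
      ext t
      simp only [Set.mem_ofPred_eq, Set.mem_empty_iff_false, iff_false]
      rintro ⟨rfl, hit⟩
      exact hi (by simpa using hit)
  · rw [Set.disjoint_left]
    rintro t ⟨ht, hl, -⟩ ⟨-, hr, -⟩
    have : t ⊆ {k} := fun w hw => by
      have := Finset.mem_Icc.1 (hl hw)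
      have := Finset.mem_Icc.1 (hr hw)
      rw [Finset.mem_singleton]
      omega
    have := Finset.card_le_card this
    rw [ht.card_eq] at this
    simp at this
  · rw [Set.disjoint_left]
    rintro t (⟨-, h, -⟩ | ⟨-, h, -⟩) ⟨rfl, -⟩
    · have := Finset.mem_Icc.1 (h (show b ∈ _ by simp))
      omega
    · have := Finset.mem_Icc.1 (h (show a ∈ _ by simp))
      omega

/-- A proper `3`-colouring of a dissection determines the parities of its triangle counts. -/
theorem Dissects.triangleCount_parity (h : Dissects G a b) (hG : CrossingFree G)
    {f : ℕ → Fin 3} (hf : ∀ u v, G.Adj u v → f u ≠ f v) :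
    ((triangleCount G a b a : ZMod 2) = if f (a + 1) = f b then 0 else 1) ∧
    ((triangleCount G a b b : ZMod 2) = if f (b - 1) = f a then 0 else 1) ∧
    ∀ i, a < i → i < b →
      ((triangleCount G a b i : ZMod 2) = if f (i - 1) = f (i + 1) then 0 else 1) := by
  induction h with
  | side a h =>
    refine ⟨by simp [triangleCount_succ], by simp [triangleCount_succ], fun i h1 h2 => ?_⟩
    omega
  | triangle a k b h hak hkb h1 h2 =>
    obtain ⟨l1, l2, l3⟩ := h1
    obtain ⟨r1, r2, r3⟩ := h2
    have hlt1 := hak.lt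
    have hlt2 := hkb.lt
    have split := triangleCount_split hG hlt1 hlt2 hak.adj hkb.adj h
    have ca := hf _ _ (hak.adj_succ le_rfl hlt1)
    have ck := hf _ _ (hkb.adj_succ le_rfl hlt2)
    have cb := hf _ _ (hkb.adj_succ (i := b - 1) (by omega) (by omega))
    have ck' := hf _ _ (hak.adj_succ (i := k - 1) (by omega) (by omega))
    rw [Nat.sub_add_cancel (by omega)] at cb ck'
    have cak := hf _ _ hak.adj
    have ckb := hf _ _ hkb.adj
    have cab := hf _ _ h
    refine ⟨?_, ?_, fun i hai hib => ?_⟩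
    -- The colours of `k` and `b` are the two colours other than that of `a`, so `a + 1` agrees with
    -- exactly one of them. Replacing `k` by `b` flips the bit, which matches the one new triangle.
    · rw [split, triangleCount_eq_zero (a := k) (.inl hlt1), if_pos (.inl rfl)]
      push_cast
      rw [l1]
      generalize f (a + 1) = p at *
      generalize f a = x at *
      generalize f k = y at *
      generalize f b = z at *
      clear * - ca cak ckb cab
      revert p x y z
      decide
    · rw [split, triangleCount_eq_zero (a := a) (.inr hlt2), if_pos (.inr (.inr rfl))]
      push_cast
      rw [r2]
      generalize f (b - 1) = p at *
      generalize f a = x at *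
      generalize f k = y at *
      generalize f b = z at *
      clear * - cb cak ckb cab
      revert p x y z
      decide
    · rcases lt_trichotomy i k with hik | rfl | hik
      · rw [split, triangleCount_eq_zero (a := k) (.inl hik), if_neg (by omega), ← l3 i hai hik]
        simp
      · rw [split, if_pos (.inr (.inl rfl))]
        push_cast
        rw [l2, r1]
        generalize f (i - 1) = p at *
        generalize f (i + 1) = q at *
        generalize f a = x at *
        generalize f i = y at *
        generalize f b = z at *
        clear * - ck ck' cak ckb cab
        revert p q x y z
        decide
      · rw [split, triangleCount_eq_zero (a := a) (.inr hik), if_neg (by omega), ← r3 i hik hib]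
        simp

/-! ### Realising a colouring by a dissection. -/

/-- Endpoints of distinct colours in a properly `3`-coloured path, together with a vertex
of the third colour between them, span a triangle whose other two sides are again sides of the
path or see a third colour. -/
theorem exists_apex (f : ℕ → Fin 3) (a b : ℕ) (hf : ∀ i, a ≤ i → i < b → f i ≠ f (i + 1))
    (hne : f a ≠ f b) (h3 : ∃ k, a < k ∧ k < b ∧ f k ≠ f a ∧ f k ≠ f b) :
    ∃ k, a < k ∧ k < b ∧ f k ≠ f a ∧ f k ≠ f b ∧
      (k = a + 1 ∨ ∃ j, a < j ∧ j < k ∧ f j ≠ f a ∧ f j ≠ f k) ∧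
      (b = k + 1 ∨ ∃ j, k < j ∧ j < b ∧ f j ≠ f k ∧ f j ≠ f b) := by
  let S := (Finset.Ioo a b).filter fun k => f k ≠ f a ∧ f k ≠ f b
  have hS (k : ℕ) : k ∈ S ↔ (a < k ∧ k < b) ∧ f k ≠ f a ∧ f k ≠ f b := by
    simp [S]
  have hne' : S.Nonempty := by
    obtain ⟨k, h⟩ := h3
    exact ⟨k, (hS k).2 ⟨⟨h.1, h.2.1⟩, h.2.2⟩⟩
  -- The first vertex `p` of the third colour is always good on its left, the last one `q` always
  -- good on its right. If `p` fails on the right, then `p + 1` has the colour of `b`, and it is the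
  -- witness making `q` good on the left.
  obtain ⟨p, hp, hpmin⟩ := S.exists_minimal hne'
  obtain ⟨q, hq, hqmax⟩ := S.exists_maximal hne'
  have third (x y z w : Fin 3) : x ≠ y → z ≠ x → z ≠ y → w ≠ x → w ≠ y → w = z := by
    revert x y z w; decide
  rw [hS] at hp hq
  have hpq : f p = f q := third _ _ _ _ hne hq.2.1 hq.2.2 hp.2.1 hp.2.2
  have hleft : p = a + 1 ∨ ∃ j, a < j ∧ j < p ∧ f j ≠ f a ∧ f j ≠ f p := by
    by_cases h : p = a + 1
    · exact .inl h
    refine .inr ⟨a + 1, by omega, by omega, (hf a le_rfl (by omega)).symm, fun heq => ?_⟩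
    have : p ≤ a + 1 := hpmin ((hS _).2 ⟨⟨by omega, by omega⟩, heq ▸ hp.2.1, heq ▸ hp.2.2⟩)
      (by omega)
    omega
  have hright : b = q + 1 ∨ ∃ j, q < j ∧ j < b ∧ f j ≠ f q ∧ f j ≠ f b := by
    by_cases h : b = q + 1
    · exact .inl h
    have hb := hf (b - 1) (by omega) (by omega)
    rw [Nat.sub_add_cancel (by omega)] at hb
    refine .inr ⟨b - 1, by omega, by omega, fun heq => ?_, hb⟩
    have : b - 1 ≤ q := hqmax ((hS _).2 ⟨⟨by omega, by omega⟩, heq ▸ hq.2.1, heq ▸ hq.2.2⟩)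
      (by omega)
    omega
  by_cases hgood : b = p + 1 ∨ ∃ j, p < j ∧ j < b ∧ f j ≠ f p ∧ f j ≠ f b
  · exact ⟨p, hp.1.1, hp.1.2, hp.2.1, hp.2.2, hleft, hgood⟩
  refine ⟨q, hq.1.1, hq.1.2, hq.2.1, hq.2.2, ?_, hright⟩
  push Not at hgood
  have hple : p ≤ q := by
    by_contra hlt
    have : p ≤ q := hpmin ((hS _).2 hq) (by omega)
    exact hlt this
  rcases hple.eq_or_lt with rfl | hlt
  · exact hleft
  have hp1 := (hf p hp.1.1.le hp.1.2).symm
  have hp2 : p + 1 ≠ q := fun h => hp1 (by rw [h, hpq])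
  have hp3 := hgood.2 (p + 1) (by omega) (by omega) hp1
  exact .inr ⟨p + 1, by omega, by omega, hp3 ▸ hne.symm, hpq ▸ hp1⟩

theorem sup_sup_edge_adj (G₁ G₂ : SimpleGraph ℕ) (hab : a ≠ b) (u v : ℕ) :
    (G₁ ⊔ G₂ ⊔ SimpleGraph.edge a b).Adj u v ↔
      (G₁.Adj u v ∨ G₂.Adj u v) ∨ ((u = a ∧ v = b) ∨ (u = b ∧ v = a)) := by
  rw [SimpleGraph.sup_adj, SimpleGraph.sup_adj, SimpleGraph.edge_adj]
  have : ((u = a ∧ v = b) ∨ (u = b ∧ v = a)) → u ≠ v := by omega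
  tauto

/-- The two graphs live on intervals meeting only in `k`, and the new edge `ab` spans both, so it
interlaces with nothing. -/
theorem CrossingFree.glue {G₁ G₂ : SimpleGraph ℕ} {k : ℕ} (hak : a < k) (hkb : k < b)
    (h₁ : CrossingFree G₁) (h₂ : CrossingFree G₂) (hs₁ : ∀ u v, G₁.Adj u v → a ≤ u ∧ u ≤ k)
    (hs₂ : ∀ u v, G₂.Adj u v → k ≤ u ∧ u ≤ b) :
    CrossingFree (G₁ ⊔ G₂ ⊔ SimpleGraph.edge a b) := by
  intro p q r s hpq hqr hrs hpr hqs
  rw [sup_sup_edge_adj _ _ (hak.trans hkb).ne] at hpr hqs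
  rcases hpr with (hpr | hpr) | hpr
  · have b1 := hs₁ p r hpr
    have b2 := hs₁ r p hpr.symm
    rcases hqs with (hqs | hqs) | hqs
    · exact h₁ p q r s hpq hqr hrs hpr hqs
    · have b3 := hs₂ q s hqs
      clear * - hak hkb b1 b2 b3 hpq hqr hrs
      omega
    · clear * - hak hkb b1 b2 hqs hpq hqr hrs
      omega
  · have b1 := hs₂ p r hpr
    have b2 := hs₂ r p hpr.symm
    rcases hqs with (hqs | hqs) | hqs
    · have b3 := hs₁ q s hqs
      clear * - hak hkb b1 b2 b3 hpq hqr hrs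
      omega
    · exact h₂ p q r s hpq hqr hrs hpr hqs
    · clear * - hak hkb b1 b2 hqs hpq hqr hrs
      omega
  · rcases hqs with (hqs | hqs) | hqs
    · have b1 := hs₁ q s hqs
      have b2 := hs₁ s q hqs.symm
      clear * - hak hkb b1 b2 hpr hpq hqr hrs
      omega
    · have b1 := hs₂ q s hqs
      have b2 := hs₂ s q hqs.symm
      clear * - hak hkb b1 b2 hpr hpq hqr hrs
      omega
    · clear * - hak hkb hqs hpr hpq hqr hrs
      omega

/-- A proper `3`-colouring of a path with distinct colours at its endpoints is a colouring of a
dissection of the path as soon as it uses three colours. -/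
theorem exists_dissects (f : ℕ → Fin 3) (a b : ℕ) (hab : a < b) (hne : f a ≠ f b)
    (hf : ∀ i, a ≤ i → i < b → f i ≠ f (i + 1))
    (h3 : b = a + 1 ∨ ∃ k, a < k ∧ k < b ∧ f k ≠ f a ∧ f k ≠ f b) :
    ∃ G : SimpleGraph ℕ, CrossingFree G ∧ (∀ u v, G.Adj u v → f u ≠ f v) ∧
      (∀ u v, G.Adj u v → a ≤ u ∧ u ≤ b) ∧ Dissects G a b := by
  induction hL : b - a using Nat.strong_induction_on generalizing a b with
  | _ L ih =>
  subst hL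
  rcases h3 with rfl | h3
  · refine ⟨SimpleGraph.edge a (a + 1), ?_, ?_, ?_, .side a ?_⟩
    · intro p q r s h1 h2 h3 h4 h5
      rw [SimpleGraph.edge_adj] at h4 h5
      omega
    · intro u v h
      rw [SimpleGraph.edge_adj] at h
      rcases h.1 with ⟨rfl, rfl⟩ | ⟨rfl, rfl⟩
      · exact hne
      · exact hne.symm
    · intro u v h
      rw [SimpleGraph.edge_adj] at h
      omega
    · rw [SimpleGraph.edge_adj]
      omega
  · obtain ⟨k, hak, hkb, hka, hkb', hl, hr⟩ := exists_apex f a b hf hne h3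
    obtain ⟨G₁, nc1, col1, sup1, dis1⟩ := ih (k - a) (by omega) a k hak hka.symm
      (fun i h1 h2 => hf i h1 (by omega)) hl rfl
    obtain ⟨G₂, nc2, col2, sup2, dis2⟩ := ih (b - k) (by omega) k b hkb hkb'
      (fun i h1 h2 => hf i (by omega) h2) hr rfl
    have hadj := sup_sup_edge_adj G₁ G₂ (hak.trans hkb).ne
    refine ⟨G₁ ⊔ G₂ ⊔ SimpleGraph.edge a b, ?_, ?_, ?_, .triangle a k b ?_
      (dis1.mono (le_sup_left.trans le_sup_left)) (dis2.mono (le_sup_right.trans le_sup_left))⟩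
    · exact nc1.glue hak hkb nc2 sup1 sup2
    · intro u v h
      rw [hadj] at h
      rcases h with (h | h) | ⟨rfl, rfl⟩ | ⟨rfl, rfl⟩
      · exact col1 u v h
      · exact col2 u v h
      · exact hne
      · exact hne.symm
    · intro u v h
      rw [hadj] at h
      rcases h with (h | h) | h
      · have := sup1 u v h; omega
      · have := sup2 u v h; omega
      · omega
    · rw [hadj]
      exact .inr (.inl ⟨rfl, rfl⟩)

end Dissection

/-! ### From maximal crossing-free graphs to dissections. -/

section Polygon

variable {k : ℕ}

theorem cycleGraph_adj_of_lt {u v : Fin (k + 1)} (huv : u < v) :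
    (SimpleGraph.cycleGraph (k + 1)).Adj u v ↔
      (v : ℕ) = u + 1 ∨ ((u : ℕ) = 0 ∧ (v : ℕ) = k) := by
  rw [SimpleGraph.cycleGraph_adj', Fin.coe_sub_iff_lt.2 huv, Fin.sub_val_of_le huv.le]
  have := Fin.lt_def.1 huv
  omega

theorem crossingFree_map_iff (G : SimpleGraph (Fin (k + 1))) :
    CrossingFree (G.map Fin.valEmbedding) ↔ CrossingFree G := by
  constructor
  · intro h a b c d hab hbc hcd hac hbd
    exact h a b c d hab hbc hcd (SimpleGraph.map_adj_apply.2 hac)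
      (SimpleGraph.map_adj_apply.2 hbd)
  · intro h a b c d hab hbc hcd hac hbd
    rw [SimpleGraph.map_adj] at hac hbd
    obtain ⟨a, c, hac, rfl, rfl⟩ := hac
    obtain ⟨b, d, hbd, rfl, rfl⟩ := hbd
    exact h a b c d hab hbc hcd hac hbd

/-- A maximal crossing-free graph containing the polygon dissects it into triangles. -/
theorem dissects_of_maximal {G : SimpleGraph (Fin (k + 1))}
    (hG : Maximal (fun H => SimpleGraph.cycleGraph (k + 1) ≤ H ∧ CrossingFree H) G)
    (a b : Fin (k + 1)) (hab : a < b) (hadj : G.Adj a b) :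
    Dissects (G.map Fin.valEmbedding) a b := by
  induction hL : (b : ℕ) - a using Nat.strong_induction_on generalizing a b with
  | _ L ih =>
  subst hL
  have hab' := Fin.lt_def.1 hab
  have hmap (u v : Fin (k + 1)) (h : G.Adj u v) :
      (G.map Fin.valEmbedding).Adj (u : ℕ) (v : ℕ) := SimpleGraph.map_adj_apply.2 h
  by_cases hb : (b : ℕ) = a + 1
  · rw [hb]
    exact .side _ (hb ▸ hmap a b hadj)
  obtain ⟨⟨hcyc, hcf⟩, hmax⟩ := hG
  classical
  -- The apex on the base `ab` is the largest neighbour `c` of `a` below `b`. An edge crossing `cb`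
  -- would cross `ab` or `ac`, or be an edge from `a` to a vertex strictly between `c` and `b`;
  -- hence `cb` can be added, and maximality puts it in `G`.
  let S := Finset.univ.filter fun c : Fin (k + 1) => a < c ∧ c < b ∧ G.Adj a c
  have hS (c : Fin (k + 1)) : c ∈ S ↔ a < c ∧ c < b ∧ G.Adj a c := by simp [S]
  have hne : S.Nonempty := by
    refine ⟨⟨a + 1, by omega⟩, (hS _).2 ⟨?_, ?_, hcyc ?_⟩⟩
    · rw [Fin.lt_def]; simp
    · rw [Fin.lt_def]; simp only; omega
    · rw [cycleGraph_adj_of_lt (by rw [Fin.lt_def]; simp)]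
      exact .inl rfl
  obtain ⟨c, hc, hcmax⟩ := S.exists_maximal hne
  obtain ⟨hac, hcb, hadjac⟩ := (hS c).1 hc
  have hadjcb : G.Adj c b := by
    have hle : G ⊔ SimpleGraph.edge c b ≤ G := by
      refine hmax ⟨hcyc.trans le_sup_left, ?_⟩ le_sup_left
      have cross (u v : Fin (k + 1)) (huv : G.Adj u v) (hlt : u < v) :
          ¬ (u < c ∧ c < v ∧ v < b) ∧ ¬ (c < u ∧ u < b ∧ b < v) := by
        constructor
        · rintro ⟨huc, hcv, hvb⟩
          rcases lt_trichotomy u a with hua | rfl | hau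
          · exact hcf u a v b hua (hac.trans hcv) hvb huv hadj
          · exact (hcmax ((hS v).2 ⟨hlt, hvb, huv⟩) hcv.le).not_gt hcv
          · exact hcf a u c v hau huc hcv hadjac huv
        · rintro ⟨hcu, hub, hbv⟩
          exact hcf a u b v (hac.trans hcu) hub hbv hadj huv
      intro p q r s hpq hqr hrs hpr hqs
      rw [SimpleGraph.sup_adj, SimpleGraph.edge_adj] at hpr hqs
      have c1 := cross p r
      have c2 := cross q s
      have c3 := hcf p q r s hpq hqr hrs
      clear * - hpr hqs c1 c2 c3 hcb hpq hqr hrs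
      rcases hpr with hpr | ⟨hpr, -⟩ <;> rcases hqs with hqs | ⟨hqs, -⟩ <;> grind
    exact hle ((SimpleGraph.sup_adj ..).2 (.inr ((SimpleGraph.edge_adj ..).2
      ⟨.inl ⟨rfl, rfl⟩, hcb.ne⟩)))
  have hac' := Fin.lt_def.1 hac
  have hcb' := Fin.lt_def.1 hcb
  exact .triangle a c b (hmap a b hadj) (ih _ (by omega) a c hac hadjac rfl)
    (ih _ (by omega) c b hcb hadjcb rfl)

theorem maximal_iff_dissects (hk : 2 ≤ k) (G : SimpleGraph (Fin (k + 1))) :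
    Maximal (fun H => SimpleGraph.cycleGraph (k + 1) ≤ H ∧ CrossingFree H) G ↔
      CrossingFree G ∧ Dissects (G.map Fin.valEmbedding) 0 k := by
  constructor
  · intro h
    have hlt : (0 : Fin (k + 1)) < Fin.last k := by rw [Fin.lt_def]; simp; omega
    have := dissects_of_maximal h 0 (Fin.last k) hlt
      (h.1.1 ((cycleGraph_adj_of_lt hlt).2 (.inr ⟨rfl, rfl⟩)))
    exact ⟨h.1.2, this⟩
  · rintro ⟨hcf, hd⟩
    refine ⟨⟨?_, hcf⟩, ?_⟩
    · have key (u v : Fin (k + 1)) (huv : u < v)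
          (h : (SimpleGraph.cycleGraph (k + 1)).Adj u v) : G.Adj u v := by
        rw [← SimpleGraph.map_adj_apply (f := Fin.valEmbedding)]
        rw [cycleGraph_adj_of_lt huv] at h
        change (G.map Fin.valEmbedding).Adj (u : ℕ) (v : ℕ)
        rcases h with h | ⟨hu, hv⟩
        · rw [h]
          exact hd.adj_succ (Nat.zero_le _) (by omega)
        · rw [hu, hv]
          exact hd.adj
      intro u v h
      rcases lt_or_gt_of_ne h.ne with huv | huv
      · exact key u v huv h
      · exact (key v u huv h.symm).symm
    · rintro H ⟨-, hH⟩ hGH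
      have key (u v : Fin (k + 1)) (huv : u < v) (h : H.Adj u v) : G.Adj u v := by
        rw [← SimpleGraph.map_adj_apply (f := Fin.valEmbedding)]
        exact hd.adj_of_le (SimpleGraph.map_monotone _ hGH) ((crossingFree_map_iff H).2 hH)
          (Nat.zero_le _) huv (Nat.le_of_lt_succ v.2) (SimpleGraph.map_adj_apply.2 h)
      intro u v h
      rcases lt_or_gt_of_ne h.ne with huv | huv
      · exact key u v huv h
      · exact (key v u huv h.symm).symm

theorem quiddity_eq_triangleCount (G : SimpleGraph (Fin (k + 1))) (i : Fin (k + 1)) :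
    quiddity G i = triangleCount (G.map Fin.valEmbedding) 0 k i := by
  rw [quiddity, triangleCount, ← Set.ncard_image_of_injective _
    (Finset.map_injective (Fin.valEmbedding (n := k + 1)))]
  congr 1
  ext t
  simp only [Set.mem_image, Set.mem_ofPred_eq]
  constructor
  · rintro ⟨s, ⟨hs, his⟩, rfl⟩
    refine ⟨(SimpleGraph.isNClique_map_iff (by norm_num)).2 ⟨s, hs, rfl⟩, fun w hw => ?_,
      Finset.mem_map_of_mem _ his⟩
    obtain ⟨w, -, rfl⟩ := Finset.mem_map.1 hw
    exact Finset.mem_Icc.2 ⟨Nat.zero_le _, Nat.le_of_lt_succ w.2⟩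
  · rintro ⟨ht, -, hit⟩
    obtain ⟨s, hs, rfl⟩ := (SimpleGraph.isNClique_map_iff (by norm_num)).1 ht
    exact ⟨s, ⟨hs, (Finset.mem_map' Fin.valEmbedding).1 hit⟩, rfl⟩

/-! ### Parity sequences as images of cycle colourings. -/

/-- The proper `3`-colourings of a path on `k + 1` vertices that start with `0` and end with `x`. -/
def pathColorings (k : ℕ) (x : Fin 3) : Set (Fin (k + 1) → Fin 3) :=
  {f | f 0 = 0 ∧ f (Fin.last k) = x ∧ ∀ i : Fin k, f i.castSucc ≠ f i.succ}

/-- The indicator of the vertices whose two neighbours on the cycle have distinct colours. -/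
def colorParity (f : Fin (k + 1) → Fin 3) (i : Fin (k + 1)) : ZMod 2 :=
  if f (i - 1) = f (i + 1) then 0 else 1

theorem paritySequence_eq_colorParity (hk : 2 ≤ k) {G : SimpleGraph (Fin (k + 1))}
    (hG : CrossingFree G) (hd : Dissects (G.map Fin.valEmbedding) 0 k) (f : Fin (k + 1) → Fin 3)
    (hf : ∀ u v, G.Adj u v → f u ≠ f v) : paritySequence G = colorParity f := by
  let g : ℕ → Fin 3 := fun i => f (Fin.ofNat (k + 1) i)
  have hg (i : Fin (k + 1)) : g i = f i := by simp [g]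
  have hg' (i : ℕ) (j : Fin (k + 1)) (h : i = j) : g i = f j := by rw [h, hg]
  have hgadj (u v : ℕ) (h : (G.map Fin.valEmbedding).Adj u v) : g u ≠ g v := by
    rw [SimpleGraph.map_adj] at h
    obtain ⟨u, v, h, rfl, rfl⟩ := h
    have := hf u v h
    rwa [← hg, ← hg] at this
  obtain ⟨h0, hlast, hmid⟩ :=
    hd.triangleCount_parity ((crossingFree_map_iff G).2 hG) hgadj
  have hone : ((1 : Fin (k + 1)) : ℕ) = 1 := by
    rw [Fin.val_one', Nat.mod_eq_of_lt (by omega)]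
  ext i
  rw [paritySequence, quiddity_eq_triangleCount, colorParity]
  by_cases hi0 : i = 0
  · subst hi0
    -- Indices in `Fin (k + 1)` wrap around, so the predecessor of `0` is the last vertex, in
    -- agreement with the base edge from `0` to `k`.
    have hneg : Fin.last k = -1 := eq_neg_of_add_eq_zero_left (Fin.last_add_one k)
    rw [Fin.val_zero, h0, zero_sub, zero_add, hg' (0 + 1) 1 (by rw [hone]),
      hg' k (-1) (by rw [← hneg, Fin.val_last])]
    simp only [eq_comm, zero_add]
  by_cases hil : i = Fin.last k
  · subst hil
    rw [Fin.val_last, hlast, Fin.last_add_one, hg' 0 0 rfl,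
      hg' (k - 1) (Fin.last k - 1) (by rw [Fin.val_sub_one_of_ne_zero hi0]; rfl)]
  · have hi1 : (i : ℕ) ≠ 0 := fun h => hi0 (Fin.ext h)
    have hi2 : (i : ℕ) ≠ k := fun h => hil (Fin.ext h)
    rw [hmid i (by omega) (by omega), hg' (i - 1) (i - 1) (Fin.val_sub_one_of_ne_zero hi0).symm,
      hg' (i + 1) (i + 1) (by rw [Fin.val_add_one, if_neg hil])]

/-- Permuting colours lets every colouring be normalised to `0` at the first vertex and `1` at the
last. The third colour then occurs at the apex of the triangle on that base, and its presence is
also what `exists_dissects` needs. -/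
theorem paritySequences_eq_image (hk : 2 ≤ k) {P : Fin (k + 1) → EuclideanSpace ℝ (Fin 2)}
    (hP : IsConvexPolygon P) :
    paritySequences P = colorParity '' {f ∈ pathColorings k 1 | ∃ j, f j = 2} := by
  have htri (G : SimpleGraph (Fin (k + 1))) : IsTriangulation P G ↔
      CrossingFree G ∧ Dissects (G.map Fin.valEmbedding) 0 k := by
    rw [← maximal_iff_dissects hk, IsTriangulation]
    simp only [isNonCrossing_iff_crossingFree hP]
  ext c
  simp only [paritySequences, Set.mem_ofPred_eq, Set.mem_image, htri]
  constructor
  · rintro ⟨G, ⟨hcf, hd⟩, rfl⟩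
    obtain ⟨g, hg0, hgk, hg⟩ :=
      hd.exists_coloring ((crossingFree_map_iff G).2 hcf) 0 1 (by decide)
    have hlt (u v : Fin (k + 1)) (huv : u < v)
        (h : (G.map Fin.valEmbedding).Adj (u : ℕ) (v : ℕ)) : g u ≠ g v :=
      hg u v (Nat.zero_le _) huv (Nat.le_of_lt_succ v.2) h
    refine ⟨fun i => g i, ⟨⟨hg0, hgk, fun i => ?_⟩, ?_⟩, ?_⟩
    · exact hlt _ _ Fin.castSucc_lt_succ (hd.adj_succ (Nat.zero_le _) i.2)
    · cases hd with
      | side => omega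
      | triangle _ m _ h h1 h2 =>
        have hm1 := h1.lt
        have hm2 := h2.lt
        refine ⟨⟨m, by omega⟩, ?_⟩
        have e1 := hg 0 m le_rfl hm1 hm2.le h1.adj
        have e2 := hg m k (Nat.zero_le _) hm2 le_rfl h2.adj
        rw [hg0] at e1
        rw [hgk] at e2
        simp only
        generalize g m = z at *
        revert z
        decide
    · refine (paritySequence_eq_colorParity hk hcf hd _ fun u v h => ?_).symm
      rcases lt_or_gt_of_ne h.ne with huv | huv
      · exact hlt u v huv (SimpleGraph.map_adj_apply.2 h)
      · exact (hlt v u huv (SimpleGraph.map_adj_apply.2 h.symm)).symm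
  · rintro ⟨f, ⟨⟨hf0, hfk, hf⟩, j, hj⟩, rfl⟩
    let g : ℕ → Fin 3 := fun i => f (Fin.ofNat (k + 1) i)
    have hg (i : Fin (k + 1)) : g i = f i := by simp [g]
    have hg0 : g 0 = 0 := by rw [← hf0, ← hg]; rfl
    have hgk : g k = 1 := by rw [← hfk, ← hg]; rfl
    have hgj : g j = 2 := by rw [hg, hj]
    obtain ⟨H, hcf, hcol, hsup, hd⟩ := exists_dissects g 0 k (by omega)
      (by rw [hg0, hgk]; decide)
      (fun i _ hi => by
        have := hf ⟨i, hi⟩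
        rwa [← hg, ← hg] at this)
      (.inr ⟨j, Nat.pos_of_ne_zero fun h => by rw [h, hg0] at hgj; exact absurd hgj (by decide),
        lt_of_le_of_ne (Nat.le_of_lt_succ j.2)
          fun h => by rw [h, hgk] at hgj; exact absurd hgj (by decide),
        by rw [hgj, hg0]; decide, by rw [hgj, hgk]; decide⟩)
    -- `H` has no edges outside `[0, k]`, so restricting it to `Fin (k + 1)` loses nothing.
    have hmap : (H.comap (Fin.valEmbedding (n := k + 1))).map Fin.valEmbedding = H := by
      ext u v
      rw [SimpleGraph.map_adj]
      constructor
      · rintro ⟨u, v, h, rfl, rfl⟩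
        exact h
      · intro h
        have hu := hsup u v h
        have hv := hsup v u h.symm
        exact ⟨⟨u, by omega⟩, ⟨v, by omega⟩, h, rfl, rfl⟩
    have hcf' : CrossingFree (H.comap (Fin.valEmbedding (n := k + 1))) := by
      rwa [← crossingFree_map_iff, hmap]
    rw [← hmap] at hd
    refine ⟨_, ⟨hcf', hd⟩, paritySequence_eq_colorParity hk hcf' hd f fun u v h => ?_⟩
    have := hcol u v h
    rwa [hg, hg] at this

/-- Given the colours at `j - 1` and `j`, the bit at `j` says whether `j + 1` repeats the colour of
`j - 1` or takes the only other one allowed. The recursion starts from the fixed pair at `-1` and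
`0`. -/
theorem colorParity_injOn (k : ℕ) : Set.InjOn colorParity (pathColorings (k + 1) 1) := by
  rintro f ⟨hf0, hfk, hf⟩ g ⟨hg0, hgk, hg⟩ hfg
  have step (x y z w : Fin 3) (hxy : x ≠ y) (hyz : y ≠ z) (hyw : y ≠ w)
      (h : (if x = z then (0 : ZMod 2) else 1) = if x = w then 0 else 1) : z = w := by
    revert x y z w; decide
  have hne (i : Fin (k + 1 + 1)) : f i ≠ f (i + 1) ∧ g i ≠ g (i + 1) := by
    induction i using Fin.lastCases with
    | last =>
      rw [Fin.last_add_one, hf0, hfk, hg0, hgk]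
      decide
    | cast i =>
      rw [Fin.coeSucc_eq_succ]
      exact ⟨hf i, hg i⟩
  have main (m : ℕ) : f (Fin.ofNat _ m) = g (Fin.ofNat _ m) ∧
      f (Fin.ofNat _ (m + 1)) = g (Fin.ofNat _ (m + 1)) := by
    have hnext (j : Fin (k + 1 + 1)) (h1 : f (j - 1) = g (j - 1)) (h2 : f j = g j) :
        f (j + 1) = g (j + 1) := by
      have h := congrFun hfg j
      simp only [colorParity] at h
      rw [← h1] at h
      refine step (f (j - 1)) (f j) _ _ ?_ (hne j).1 (h2 ▸ (hne j).2) h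
      have := (hne (j - 1)).1
      rwa [sub_add_cancel] at this
    have hcast (m : ℕ) : Fin.ofNat (k + 1 + 1) (m + 1) = Fin.ofNat (k + 1 + 1) m + 1 := by
      ext
      simp [Fin.val_add]
    induction m with
    | zero =>
      have h0 : f 0 = g 0 := by rw [hf0, hg0]
      refine ⟨h0, ?_⟩
      rw [hcast]
      refine hnext 0 ?_ h0
      rw [zero_sub, ← eq_neg_of_add_eq_zero_left (Fin.last_add_one (k + 1)), hfk, hgk]
    | succ m ih =>
      refine ⟨ih.2, ?_⟩
      rw [hcast (m + 1)]
      refine hnext _ ?_ ih.2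
      rw [hcast, add_sub_cancel_right]
      exact ih.1
  ext i
  have := (main i).1
  rw [Fin.ofNat_val_eq_self] at this
  rw [this]

/-! ### Counting the colourings. -/

theorem ncard_pathColorings_succ (k : ℕ) {x y z : Fin 3} (hxy : x ≠ y) (hxz : x ≠ z)
    (hyz : y ≠ z) : (pathColorings (k + 1) x).ncard =
      (pathColorings k y).ncard + (pathColorings k z).ncard := by
  have hdis : Disjoint (pathColorings k y) (pathColorings k z) := by
    rw [Set.disjoint_left]
    rintro f ⟨-, h1, -⟩ ⟨-, h2, -⟩
    exact hyz (h1.symm.trans h2)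
  have hinj : Function.Injective
      (fun f : Fin (k + 1) → Fin 3 => (Fin.snoc f x : Fin (k + 1 + 1) → Fin 3)) := by
    intro f g h
    have := congrArg Fin.init h
    simpa only [Fin.init_snoc] using this
  rw [← Set.ncard_union_eq hdis (Set.toFinite _) (Set.toFinite _),
    ← Set.ncard_image_of_injective _ hinj]
  congr 1
  have hcases (w : Fin 3) : w ≠ x ↔ w = y ∨ w = z := by
    clear * - hxy hxz hyz
    revert x y z w; decide
  have hsnoc (f : Fin (k + 1) → Fin 3) :
      (Fin.snoc f x : Fin (k + 1 + 1) → Fin 3) ∈ pathColorings (k + 1) x ↔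
        f ∈ pathColorings k y ∪ pathColorings k z := by
    simp only [pathColorings, Set.mem_union, Set.mem_ofPred_eq]
    rw [Fin.forall_fin_succ', ← Fin.castSucc_zero, Fin.succ_last]
    simp only [Fin.snoc_castSucc, Fin.snoc_last, ← Fin.castSucc_succ, hcases]
    tauto
  ext f
  rw [Set.mem_image]
  constructor
  · intro hf
    have hx : f (Fin.last (k + 1)) = x := hf.2.1
    have heq : (Fin.snoc (Fin.init f) x : Fin (k + 1 + 1) → Fin 3) = f := by
      rw [← hx]
      exact Fin.snoc_init_self f
    refine ⟨Fin.init f, ?_, heq⟩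
    rw [← hsnoc, heq]
    exact hf
  · rintro ⟨g, hg, rfl⟩
    exact (hsnoc g).2 hg

/-- These count walks of length `k` in the complete graph on three vertices, whose adjacency
eigenvalues are `2` and `-1`. The three cases are proved together because the recursion mixes them.
-/
theorem three_mul_ncard_pathColorings (k : ℕ) :
    3 * ((pathColorings k 0).ncard : ℚ) = 2 ^ k + 2 * (-1) ^ k ∧
    3 * ((pathColorings k 1).ncard : ℚ) = 2 ^ k - (-1) ^ k ∧
    3 * ((pathColorings k 2).ncard : ℚ) = 2 ^ k - (-1) ^ k := by
  induction k with
  | zero =>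
    have h0 : pathColorings 0 0 = {fun _ => 0} := by
      ext f
      rw [Set.mem_singleton_iff]
      constructor
      · intro hf
        ext i
        rw [Subsingleton.elim (α := Fin 1) i 0, hf.1]
      · rintro rfl
        exact ⟨rfl, rfl, fun i => i.elim0⟩
    have h1 (x : Fin 3) (hx : x ≠ 0) : pathColorings 0 x = ∅ := by
      rw [Set.eq_empty_iff_forall_notMem]
      intro f hf
      exact hx (hf.2.1.symm.trans hf.1)
    rw [h0, h1 1 (by decide), h1 2 (by decide)]
    norm_num
  | succ k ih =>
    rw [ncard_pathColorings_succ k (x := 0) (y := 1) (z := 2) (by decide) (by decide) (by decide),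
      ncard_pathColorings_succ k (x := 1) (y := 0) (z := 2) (by decide) (by decide) (by decide),
      ncard_pathColorings_succ k (x := 2) (y := 0) (z := 1) (by decide) (by decide) (by decide)]
    push_cast
    obtain ⟨i0, i1, i2⟩ := ih
    refine ⟨?_, ?_, ?_⟩ <;> rw [mul_add] <;> simp only [i0, i1, i2] <;> ring

/-- The only colouring without the third colour is the alternating one. -/
theorem ncard_pathColorings_no_two (k : ℕ) :
    {f ∈ pathColorings k 1 | ¬ ∃ j, f j = 2}.ncard = if Odd k then 1 else 0 := by
  let alt : Fin (k + 1) → Fin 3 := fun i => if Even (i : ℕ) then 0 else 1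
  have halt (f : Fin (k + 1) → Fin 3) (hf : f ∈ pathColorings k 1) (h2 : ¬ ∃ j, f j = 2) :
      f = alt := by
    push Not at h2
    ext i : 1
    induction i using Fin.induction with
    | zero => simpa [alt] using hf.1
    | succ i ih =>
      have h := hf.2.2 i
      have h3 := h2 i.succ
      rw [ih] at h
      simp only [alt, Fin.val_castSucc, Fin.val_succ, Nat.even_add_one] at h ⊢
      generalize f i.succ = z at *
      by_cases hi : Even (i : ℕ) <;> simp only [hi, not_true, not_false_eq_true, if_true, if_false]
        at h ⊢ <;> clear * - h h3 <;> revert z <;> decide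
  split_ifs with hk
  · rw [Set.ncard_eq_one]
    refine ⟨alt, Set.eq_singleton_iff_unique_mem.2 ⟨⟨⟨?_, ?_, fun i => ?_⟩, ?_⟩,
      fun f hf => halt f hf.1 hf.2⟩⟩
    · simp [alt]
    · simp [alt, hk]
    · simp only [alt, Fin.val_castSucc, Fin.val_succ, Nat.even_add_one]
      split_ifs <;> simp_all
    · rintro ⟨j, hj⟩
      simp only [alt] at hj
      split_ifs at hj <;> exact absurd hj (by decide)
  · rw [Set.ncard_eq_zero (Set.toFinite _), Set.eq_empty_iff_forall_notMem]
    rintro f ⟨hf, h2⟩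
    have h := hf.2.1
    rw [halt f hf h2] at h
    simp only [alt, Fin.val_last, if_pos (Nat.not_odd_iff_even.1 hk)] at h
    exact absurd h (by decide)

/-- The summand for odd `k` restores the alternating two-coloured colouring, which exists only when
the cycle length `k + 1` is even. -/
theorem ncard_paritySequences (hk : 2 ≤ k) {P : Fin (k + 1) → EuclideanSpace ℝ (Fin 2)}
    (hP : IsConvexPolygon P) :
    3 * (((paritySequences P).ncard : ℚ) + if Odd k then 1 else 0) = 2 ^ k - (-1) ^ k := by
  obtain ⟨l, rfl⟩ : ∃ l, k = l + 1 := ⟨k - 1, by omega⟩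
  rw [paritySequences_eq_image hk hP,
    Set.InjOn.ncard_image ((colorParity_injOn l).mono fun f hf => hf.1),
    ← (three_mul_ncard_pathColorings (l + 1)).2.1]
  have hsplit : pathColorings (l + 1) 1 = {f ∈ pathColorings (l + 1) 1 | ∃ j, f j = 2} ∪
      {f ∈ pathColorings (l + 1) 1 | ¬ ∃ j, f j = 2} := by
    ext f
    simp only [Set.mem_union, Set.mem_ofPred_eq]
    tauto
  have hdis : Disjoint {f ∈ pathColorings (l + 1) 1 | ∃ j, f j = 2}
      {f ∈ pathColorings (l + 1) 1 | ¬ ∃ j, f j = 2} := by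
    rw [Set.disjoint_left]
    rintro f ⟨-, h1⟩ ⟨-, h2⟩
    exact h2 h1
  conv_rhs => rw [hsplit]
  rw [Set.ncard_union_eq hdis (Set.toFinite _) (Set.toFinite _), ncard_pathColorings_no_two]
  push_cast
  rfl

end Polygon

theorem proposition2p9 (n : ℕ) (hn : 3 ≤ n) (P : Fin n → EuclideanSpace ℝ (Fin 2))
    (hP : IsConvexPolygon P) :
    (Odd n → ((paritySequences P).ncard : ℚ) = qInteger 4 ((n - 1) / 2)) ∧
      (∀ m : ℕ, n = 2 * m →
        ((paritySequences P).ncard : ℚ) = qBinomTwo 2 m + 2 ^ (m - 1) - 1) := by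
  obtain ⟨k, rfl⟩ : ∃ k, n = k + 1 := ⟨n - 1, by omega⟩
  have h := ncard_paritySequences (by omega) hP
  refine ⟨fun hodd => ?_, fun m hm => ?_⟩
  · obtain ⟨j, hj⟩ := hodd
    obtain rfl : k = 2 * j := by omega
    rw [if_neg (by simp), pow_mul, pow_mul] at h
    rw [qInteger, show (2 * j + 1 - 1) / 2 = j by omega]
    norm_num at h ⊢
    linarith
  · obtain ⟨l, rfl⟩ : ∃ l, m = l + 1 := ⟨m - 1, by omega⟩
    obtain rfl : k = 2 * l + 1 := by omega
    -- With `x = 2 ^ l`, both sides reduce to `(2 * x ^ 2 - 2) / 3`: the binomial is `(2 * x - 1) *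
    -- (x - 1) / 3`, and `x - 1` is added to it.
    have hpow : (2 : ℚ) ^ (2 * l + 1) = 2 * (2 ^ l) ^ 2 := by ring
    rw [if_pos (by simp), hpow, Odd.neg_one_pow (by simp)] at h
    rw [qBinomTwo, Nat.add_sub_cancel, pow_succ]
    norm_num at h ⊢
    linarith
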